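/- Let $n\in\mathbb N$ and, for each $i\in\{1,\dots,n\}$, let $X^i$ be a real Hausdorff locally convex topological vector space, $E^i\subseteq X^i$ a nonempty convex compact set, and $D^i\subseteq E^i$ a subset that is self segment-dense in $E^i$, i.e. $D^i$ is dense in $E^i$ and for all $x,y\in D^i$ the set $[x,y]\cap D^i$ is dense in the closed segment $[x,y]$. Write $E=\prod_{j}E^j$, $\widehat E^i=\prod_{j\ne i}E^j$, $\widehat D^i=\prod_{j\neq i}D^j$, and for $x\in E$ write $x=(x^i,\widehat x^i)$ with $\widehat x^i=(x^j)_{j\ne i}\in\widehat E^i$. Let $f^i:E\to\mathbb R$ $(i=1,\dots,n)$ be loss functions such that for every $i$: (i) $f^i$ is lower semicontinuous on $E$; (ii) for every $y^i\in D^i$ the map $\widehat x^i\mapsto f^i(y^i,\widehat x^i)$ is upper semicontinuous on $\widehat E^i$; (iii) for every $\widehat x^i\in\widehat E^i$ the map $y^i\mapsto f^i(y^i,\widehat x^i)$, as a function on $E^i$, is upper semicontinuous at every point of $E^i\setminus D^i$; (iv) for every $\widehat x^i\in\widehat D^i$ the map $y^i\mapsto f^i(y^i,\widehat x^i)$ is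 convex on $D^i$, in the sense that $f^i\big(\sum_{k=1}^m\lambda_k y_k,\widehat x^i\big)\le\sum_{k=1}^m\lambda_k f^i(y_k,\widehat x^i)$ whenever $y_1,\dots,y_m\in D^i$, $\lambda_k\ge0$, $\sum_{k=1}^m\lambda_k=1$ and $\sum_{k=1}^m\lambda_k y_k\in D^i$. Then there exists a non-cooperative (Nash) equilibrium, i.e. a point $x\in E$ that is a fixed point of the set-valued map $C(x)=\prod_{i=1}^n C^i(\widehat x^i)$, where $C^i(\widehat x^i)=\{a\in E^i : f^i(a,\widehat x^i)=\inf_{y\in E^i}f^i(y,\widehat x^i)\}$. -/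

import Mathlib

namespace SelfSegmentDense

/-- `U` is self segment-dense in the (convex) set `V`: `U` is a dense subset of `V`, and for all
`x, y ∈ U` the set `[x, y] ∩ U` is dense in the closed segment `[x, y]`. -/
structure IsSelfSegmentDense {X : Type*} [AddCommGroup X] [Module ℝ X] [TopologicalSpace X]
    (U V : Set X) : Prop where
  subset : U ⊆ V
  dense : V ⊆ closure U
  segment_dense : ∀ x ∈ U, ∀ y ∈ U, segment ℝ x y ⊆ closure (segment ℝ x y ∩ U)

/-- Convexity of a real function on a set `K` that need not be convex: Jensen's inequality for all
finite convex combinations of points of `K` that belong to `K`. -/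
def IsConvexOnSet {X : Type*} [AddCommGroup X] [Module ℝ X] (K : Set X) (g : X → ℝ) : Prop :=
  ∀ (m : ℕ) (x : Fin m → X) (c : Fin m → ℝ), (∀ k, x k ∈ K) → (∀ k, 0 ≤ c k) → ∑ k, c k = 1 →
    ∑ k, c k • x k ∈ K → g (∑ k, c k • x k) ≤ ∑ k, c k * g (x k)

/-- `g` is upper semicontinuous, as a function on the set `V`, at every point of `S`. The
neighbourhoods are those in `V`, not those in `S`. -/
def UpperSemicontinuousAtPointsOf {X : Type*} [TopologicalSpace X] (V S : Set X) (g : X → ℝ) :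
    Prop :=
  ∀ y ∈ S, UpperSemicontinuousWithinAt g V y

section Game

variable {n : ℕ} {X : Fin n → Type*}

/-- The set of multistrategies `E = ∏ E j`. -/
def multistrategies (E : ∀ j, Set (X j)) : Set (∀ j, X j) :=
  {x | ∀ j, x j ∈ E j}

/-- The product of the sets `E j` over all players `j ≠ i`. -/
def othersSet (E : ∀ j, Set (X j)) (i : Fin n) : Set (∀ j : {j // j ≠ i}, X j) :=
  {z | ∀ j : {j // j ≠ i}, z j ∈ E j}

/-- The strategies in `x` of all players other than `i`. -/
def others (i : Fin n) (x : ∀ j, X j) : ∀ j : {j // j ≠ i}, X j :=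
  fun j => x j

/-- The multistrategy in which player `i` plays `y` and the others play `z`. -/
def profile (i : Fin n) (y : X i) (z : ∀ j : {j // j ≠ i}, X j) : ∀ j, X j :=
  (Equiv.piSplitAt i X).symm (y, z)

theorem profile_self (i : Fin n) (y : X i) (z : ∀ j : {j // j ≠ i}, X j) :
    profile i y z i = y := by
  simp [profile, Equiv.piSplitAt]

theorem profile_of_ne (i : Fin n) (y : X i) (z : ∀ j : {j // j ≠ i}, X j) (j : {j // j ≠ i}) :
    profile i y z j = z j := by
  simp [profile, Equiv.piSplitAt, j.2]

/-- The decision rule of player `i`: the strategies in `E i` at which the infimum over `E i` of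
the loss of player `i`, the others playing `z`, is attained. -/
def decisionRule (E : ∀ j, Set (X j)) (f : Fin n → (∀ j, X j) → ℝ) (i : Fin n)
    (z : ∀ j : {j // j ≠ i}, X j) : Set (X i) :=
  {a | a ∈ E i ∧ IsGLB ((fun y => f i (profile i y z)) '' E i) (f i (profile i a z))}

/-- The product of the decision rules of all the players. -/
def decisionMap (E : ∀ j, Set (X j)) (f : Fin n → (∀ j, X j) → ℝ) (x : ∀ j, X j) :
    Set (∀ j, X j) :=
  {a | ∀ i, a i ∈ decisionRule E f i (others i x)}

/-- A non-cooperative (Nash) equilibrium: a multistrategy that is a fixed point of the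
set-valued decision map. -/
def IsNoncooperativeEquilibrium (E : ∀ j, Set (X j)) (f : Fin n → (∀ j, X j) → ℝ)
    (x : ∀ j, X j) : Prop :=
  x ∈ multistrategies E ∧ x ∈ decisionMap E f x

end Game

end SelfSegmentDense

/-! It suffices that no deviation `y ∈ E i` lowers the loss of any player `i`. Density of `D i` and
upper semicontinuity off `D i` reduce this to `y ∈ D i`. For such `y`, the multistrategies against
which `y` brings no gain form a closed set (a lower semicontinuous function bounded by an upper
semicontinuous one), so by compactness finitely many deviations may be treated at a time:
`exists_forall_finset_le`.

For finite sets of alternatives, the mixing weights range over a product of simplices. The KKM-type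
lemma `exists_forall_mem_of_forall_exists_pos` yields the point, provided that at every mixture each
player has an alternative of positive weight that brings no gain. If all coordinates of the mixture
lie in the `D j`, this is Jensen's inequality. Otherwise the mixture is a limit of such points in
the hulls of the same alternatives, by `IsSelfSegmentDense.convexHull_subset_closure`, and
closedness carries the property over.

The KKM lemma rests on Brouwer's theorem for products of simplices, hence for one simplex, which
follows from Scarf's lemma: a parity argument on rankings that replaces triangulations and Sperner's
lemma. -/

open Filter Topology

/-! ### Scarf's combinatorial lemma -/

/-- A finite set `P` is dominant for the family `r` of rankings if no element is ranked strictly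
above the minimum of `P` by all the rankings. -/
def IsDominant {A I : Type*} (r : I → A → ℕ) (P : Finset A) : Prop :=
  ∀ y, ∃ i, ∀ p ∈ P, r i y ≤ r i p

theorem IsDominant.mono {A I : Type*} {r : I → A → ℕ} {P Q : Finset A} (h : IsDominant r P)
    (hQ : Q ⊆ P) : IsDominant r Q := fun y =>
  let ⟨i, hi⟩ := h y
  ⟨i, fun p hp => hi p (hQ hp)⟩

section Scarf

variable {A I : Type*} [Fintype A] [DecidableEq A] [Fintype I] [DecidableEq I]
  {r : I → A → ℕ}

/-- A dominant set with one element less than there are rankings can be completed to a dominant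
set in exactly two ways, if its minima can be exceeded in all rankings but any given one. -/
theorem IsDominant.exists_completions (hr : ∀ i, Function.Injective (r i)) {τ : Finset A}
    (hτ : IsDominant r τ) (hne : τ.Nonempty) (hcard : τ.card + 1 = Fintype.card I)
    (hbig : ∀ i, ∃ y, ∀ j, j ≠ i → ∃ p ∈ τ, r j p < r j y) :
    ∃ x₁ x₂, x₁ ≠ x₂ ∧ ∀ x, (x ∉ τ ∧ IsDominant r (insert x τ)) ↔ x = x₁ ∨ x = x₂ := by
  -- Let `m i` be the minimum of `τ` in ranking `i`. Dominance makes `m` surjective onto `τ`, which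
  -- has one element less than `I`, so exactly one pair `i₁`, `i₂` shares its minimum. Only one of
  -- these two indices can be freed for a new element: it must beat the minima in all the other
  -- rankings and be the highest such element in the freed one.
  classical
  have hmin : ∀ i, ∃ p ∈ τ, ∀ q ∈ τ, r i p ≤ r i q := fun i => τ.exists_min_image (r i) hne
  choose m hmτ hm using hmin
  have hsurj : ∀ p ∈ τ, ∃ i, m i = p := by
    intro p hp
    obtain ⟨i, hi⟩ := hτ p
    exact ⟨i, hr i (le_antisymm (hm i p hp) (hi _ (hmτ i)))⟩
  -- at most one index may be removed while keeping all the minima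
  have hcount : ∀ s : Finset I, (∀ p ∈ τ, ∃ k, k ∉ s ∧ m k = p) → s.card ≤ 1 := by
    intro s hs
    have h1 : τ ⊆ sᶜ.image m := by
      intro p hp
      obtain ⟨k, hk, rfl⟩ := hs p hp
      exact Finset.mem_image_of_mem _ (by simpa using hk)
    have h2 := (Finset.card_le_card h1).trans Finset.card_image_le
    rw [Finset.card_compl] at h2
    have := s.card_le_univ
    omega
  obtain ⟨i₁, i₂, h12, hm12⟩ : ∃ i₁ i₂, i₁ ≠ i₂ ∧ m i₁ = m i₂ := by
    obtain ⟨a, -, b, -, hab, h⟩ := Finset.exists_ne_map_eq_of_card_lt_of_maps_to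
      (s := (Finset.univ : Finset I)) (t := τ) (f := m) (by simp; omega) (fun i _ => hmτ i)
    exact ⟨a, b, hab, h⟩
  have hpair : ∀ i j, i ≠ j → m i = m j → i = i₁ ∨ i = i₂ := by
    intro i j hij h
    by_contra! hcon
    have : ({i, i₁} : Finset I).card ≤ 1 := by
      apply hcount
      intro p hp
      obtain ⟨k, rfl⟩ := hsurj p hp
      by_cases hki : k = i
      · subst hki
        by_cases hj : j = i₁
        · exact ⟨i₂, by simp [h12.symm, hcon.2.symm], by rw [← hm12, ← hj, h]⟩
        · exact ⟨j, by simp [hj, hij.symm], h.symm⟩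
      · by_cases hk1 : k = i₁
        · subst hk1
          exact ⟨i₂, by simp [h12.symm, hcon.2.symm], hm12.symm⟩
        · exact ⟨k, by simp [hki, hk1], rfl⟩
    rw [Finset.card_pair hcon.1] at this
    omega
  have hsurj' : ∀ i, i = i₁ ∨ i = i₂ → ∀ p ∈ τ, ∃ k, k ≠ i ∧ m k = p := by
    intro i hi p hp
    obtain ⟨k, rfl⟩ := hsurj p hp
    by_cases hk : k = i
    · subst hk
      rcases hi with rfl | rfl
      · exact ⟨i₂, h12.symm, hm12.symm⟩
      · exact ⟨i₁, h12, hm12⟩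
    · exact ⟨k, hk, rfl⟩
  let M : I → Finset A := fun i => Finset.univ.filter fun y => ∀ j, j ≠ i → r j (m j) < r j y
  have hM : ∀ i y, y ∈ M i ↔ ∀ j, j ≠ i → r j (m j) < r j y := by simp [M]
  have hMmax : ∀ i, ∃ x ∈ M i, ∀ y ∈ M i, r i y ≤ r i x := by
    intro i
    apply Finset.exists_max_image
    obtain ⟨y, hy⟩ := hbig i
    refine ⟨y, (hM i y).2 fun j hj => ?_⟩
    obtain ⟨p, hp, hpy⟩ := hy j hj
    exact (hm j p hp).trans_lt hpy
  choose x hxM hxmax using hMmax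
  refine ⟨x i₁, x i₂, ?_, fun z => ⟨?_, ?_⟩⟩
  -- A common value would beat the minimum of `τ` in every ranking.
  · intro h
    obtain ⟨j, hj⟩ := hτ (x i₁)
    have hj' := hj _ (hmτ j)
    by_cases hj1 : j = i₁
    · have := (hM _ _).1 (hxM i₂) j (by rw [hj1]; exact h12)
      rw [← h] at this
      omega
    · have := (hM _ _).1 (hxM i₁) j hj1
      omega
  · rintro ⟨hz, hdom⟩
    obtain ⟨i, hi⟩ := hdom z
    have hik : ∀ j, r j z < r j (m j) ∨ r j (m j) < r j z := by
      intro j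
      apply lt_or_gt_of_ne
      intro h
      exact hz (hr j h ▸ hmτ j)
    -- In a ranking where `z` falls below `τ`, the minimum of the enlarged set is `z`, so the
    -- elements of `τ` must be the minima in the remaining rankings. By `hcount` this happens in at
    -- most one ranking.
    have hcov : ∀ s : Finset I, (∀ k ∈ s, r k z < r k (m k)) →
        ∀ p ∈ τ, ∃ k, k ∉ s ∧ m k = p := by
      intro s hs p hp
      obtain ⟨k, hk⟩ := hdom p
      have hkp : m k = p :=
        hr k (le_antisymm (hm k p hp) (hk _ (Finset.mem_insert_of_mem (hmτ k))))
      refine ⟨k, fun hks => ?_, hkp⟩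
      have h1 := hs k hks
      have h2 := hk z (Finset.mem_insert_self _ _)
      rw [hkp] at h1
      omega
    have hiz : r i z < r i (m i) := by
      have := hi _ (Finset.mem_insert_of_mem (hmτ i))
      rcases hik i with h | h <;> omega
    have hzM : z ∈ M i := by
      rw [hM]
      intro j hj
      refine (hik j).resolve_left fun hlt => ?_
      have := hcount {i, j} (hcov _ (by simp [hiz, hlt]))
      rw [Finset.card_pair hj.symm] at this
      omega
    have hi12 : i = i₁ ∨ i = i₂ := by
      obtain ⟨k, hk, hk'⟩ := hcov {i} (by simpa using hiz) (m i) (hmτ i)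
      exact hpair i k (by simpa [eq_comm] using hk) hk'.symm
    have hmx : ∀ y ∈ M i, r i y ≤ r i z := by
      intro y hy
      obtain ⟨j, hj⟩ := hdom y
      by_cases hji : j = i
      · subst hji
        exact hj _ (Finset.mem_insert_self _ _)
      · have h1 := (hM _ _).1 hy j hji
        have h2 := hj _ (Finset.mem_insert_of_mem (hmτ j))
        omega
    have hzx : z = x i := hr i (le_antisymm (hxmax i z hzM) (hmx _ (hxM i)))
    rcases hi12 with rfl | rfl
    · exact Or.inl hzx
    · exact Or.inr hzx
  · intro hz
    obtain ⟨i, hi12, rfl⟩ : ∃ i, (i = i₁ ∨ i = i₂) ∧ z = x i := by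
      rcases hz with h | h
      · exact ⟨i₁, Or.inl rfl, h⟩
      · exact ⟨i₂, Or.inr rfl, h⟩
    have hxi := (hM _ _).1 (hxM i)
    constructor
    · intro hmem
      obtain ⟨k, hk, hk'⟩ := hsurj' i hi12 _ hmem
      have := hxi k hk
      rw [hk'] at this
      exact lt_irrefl _ this
    · intro y
      by_cases hy : y ∈ M i
      · obtain ⟨j, hj⟩ := hτ y
        have hji : j = i := by
          by_contra hji
          have h1 := (hM _ _).1 hy j hji
          have h2 := hj _ (hmτ j)
          omega
        subst hji
        exact ⟨j, by simpa using ⟨hxmax j y hy, hj⟩⟩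
      · rw [hM] at hy
        push Not at hy
        obtain ⟨j, hji, hj⟩ := hy
        refine ⟨j, ?_⟩
        simp only [Finset.mem_insert, forall_eq_or_imp]
        exact ⟨hj.trans (hxi j hji).le, fun p hp => hj.trans (hm j p hp)⟩

/-- **Scarf's lemma.** -/
theorem exists_isDominant_image_eq_univ (hr : ∀ i, Function.Injective (r i)) (s : I → A)
    (hs : Function.Injective s) (hs_min : ∀ i a, r i (s i) ≤ r i a)
    (hs_max : ∀ i j a, j ≠ i → a ∉ Set.range s → r i a < r i (s j))
    (c : A → I) (hc : ∀ i, c (s i) = i) (hA : ∃ a, a ∉ Set.range s) [Nonempty I] :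
    ∃ P : Finset A, IsDominant r P ∧ P.image c = Finset.univ := by
  classical
  -- Double counting of pairs door ⊆ room. Without a fully coloured dominant set, every room has
  -- zero or two doors; every door lies in zero or two rooms, except `τ₀`, which lies in exactly
  -- one. The total would be both even and odd.
  by_contra! hcon
  obtain ⟨i₀⟩ := ‹Nonempty I›
  let rooms : Finset (Finset A) :=
    Finset.univ.filter fun P => IsDominant r P ∧ P.card = Fintype.card I
  let doors : Finset (Finset A) := Finset.univ.filter fun τ =>
    τ.image c = Finset.univ.erase i₀ ∧ τ.card + 1 = Fintype.card I
  let τ₀ : Finset A := (Finset.univ.erase i₀).image s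
  have hrooms : ∀ P, P ∈ rooms ↔ IsDominant r P ∧ P.card = Fintype.card I := by simp [rooms]
  have hdoors : ∀ τ, τ ∈ doors ↔
      τ.image c = Finset.univ.erase i₀ ∧ τ.card + 1 = Fintype.card I := by simp [doors]
  have hcardI : (Finset.univ.erase i₀).card + 1 = Fintype.card I := by
    rw [Finset.card_erase_add_one (Finset.mem_univ _), Finset.card_univ]
  have hτ₀ : τ₀ ∈ doors := by
    rw [hdoors]
    refine ⟨?_, ?_⟩
    · rw [Finset.image_image]
      rw [show c ∘ s = id from funext hc, Finset.image_id]
    · rw [Finset.card_image_of_injective _ hs, hcardI]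
  have hdc := Finset.sum_card_bipartiteAbove_eq_sum_card_bipartiteBelow
    (s := rooms) (t := doors) (fun P τ => τ ⊆ P)
  -- the rooms around a door
  have hbelow : ∀ τ ∈ doors, Finset.bipartiteBelow (fun P τ => τ ⊆ P) rooms τ =
      (Finset.univ.filter fun x => x ∉ τ ∧ IsDominant r (insert x τ)).image (insert · τ) := by
    intro τ hτ
    rw [hdoors] at hτ
    ext P
    simp only [Finset.mem_bipartiteBelow, hrooms, Finset.mem_image, Finset.mem_filter,
      Finset.mem_univ, true_and]
    constructor
    · rintro ⟨⟨hP, hPc⟩, hτP⟩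
      obtain ⟨x, hx⟩ : ∃ x, P \ τ = {x} := by
        rw [← Finset.card_eq_one, Finset.card_sdiff_of_subset hτP]
        omega
      have hxP : insert x τ = P := by
        rw [← Finset.sdiff_union_of_subset hτP, hx, Finset.insert_eq]
      refine ⟨x, ⟨?_, hxP ▸ hP⟩, hxP⟩
      have : x ∈ P \ τ := hx ▸ Finset.mem_singleton_self x
      exact (Finset.mem_sdiff.1 this).2
    · rintro ⟨x, ⟨hx, hd⟩, rfl⟩
      refine ⟨⟨hd, ?_⟩, Finset.subset_insert _ _⟩
      rw [Finset.card_insert_of_notMem hx]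
      exact hτ.2
  have hbelow_card : ∀ τ ∈ doors, (Finset.bipartiteBelow (fun P τ => τ ⊆ P) rooms τ).card =
      (Finset.univ.filter fun x => x ∉ τ ∧ IsDominant r (insert x τ)).card := by
    intro τ hτ
    rw [hbelow τ hτ, Finset.card_image_of_injOn]
    intro x hx y hy hxy
    simp only [Finset.coe_filter, Finset.mem_univ, true_and, Set.mem_ofPred_eq] at hx hy
    have : x ∈ insert y τ := by
      rw [← show insert x τ = insert y τ from hxy]
      exact Finset.mem_insert_self _ _
    exact (Finset.mem_insert.1 this).resolve_right hx.1
  have hinner : ∀ τ ∈ doors, τ ≠ τ₀ →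
      Even (Finset.bipartiteBelow (fun P τ => τ ⊆ P) rooms τ).card := by
    intro τ hτ hne
    rw [hbelow_card τ hτ]
    by_cases hdom : IsDominant r τ
    · obtain ⟨hτc, hτcard⟩ := (hdoors τ).1 hτ
      obtain ⟨t, htτ, ht⟩ : ∃ t ∈ τ, t ∉ Set.range s := by
        by_contra! hall
        refine hne (Finset.eq_of_subset_of_card_le ?_ ?_)
        · intro p hp
          obtain ⟨i, rfl⟩ := hall p hp
          have : c (s i) ∈ τ.image c := Finset.mem_image_of_mem _ hp
          rw [hτc, hc] at this
          exact Finset.mem_image_of_mem _ this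
        · have := ((hdoors τ₀).1 hτ₀).2
          omega
      -- The element `s i` beats `t`, which is not in the range of `s`, in every ranking but `i`.
      obtain ⟨x₁, x₂, h12, hx⟩ := hdom.exists_completions hr ⟨t, htτ⟩ hτcard
        (fun i => ⟨s i, fun j hj => ⟨t, htτ, hs_max j i t hj.symm ht⟩⟩)
      have : (Finset.univ.filter fun x => x ∉ τ ∧ IsDominant r (insert x τ)) = {x₁, x₂} := by
        ext x
        simp [hx]
      rw [this, Finset.card_pair h12]
      exact even_two
    · have : (Finset.univ.filter fun x => x ∉ τ ∧ IsDominant r (insert x τ)) = ∅ := by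
        ext x
        simpa using fun _ h => hdom (IsDominant.mono h (Finset.subset_insert _ _))
      simp [this]
  have houter : (Finset.bipartiteBelow (fun P τ => τ ⊆ P) rooms τ₀).card = 1 := by
    rw [hbelow_card τ₀ hτ₀]
    obtain ⟨a, ha⟩ := hA
    have hnot : ∀ x, x ∉ τ₀ ↔ ∀ j, j ≠ i₀ → x ≠ s j := by
      intro x
      simp [τ₀, eq_comm]
    -- Each `s j` with `j ≠ i₀` is already lowest in ranking `j`, so only ranking `i₀` can be freed,
    -- and the sole completion is the highest remaining element there.
    obtain ⟨x, hx, hxmax⟩ := Finset.exists_max_image τ₀ᶜ (r i₀)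
      ⟨a, by rw [Finset.mem_compl, hnot]; rintro j - rfl; exact ha ⟨j, rfl⟩⟩
    rw [Finset.mem_compl] at hx
    rw [Finset.card_eq_one]
    refine ⟨x, ?_⟩
    ext y
    simp only [Finset.mem_filter, Finset.mem_univ, true_and, Finset.mem_singleton]
    constructor
    · rintro ⟨hy, hd⟩
      obtain ⟨j, hj⟩ := hd x
      have hj0 : j = i₀ := by
        by_contra hj0
        have h1 := hj (s j) (Finset.mem_insert_of_mem
          (Finset.mem_image_of_mem _ (by simpa using hj0)))
        exact (hnot x).1 hx j hj0 (hr j (le_antisymm h1 (hs_min j x)))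
      subst hj0
      exact hr j (le_antisymm (hxmax y (by simpa using hy)) (hj y (Finset.mem_insert_self _ _)))
    · rintro rfl
      refine ⟨hx, fun z => ?_⟩
      by_cases hz : z ∈ τ₀
      · obtain ⟨j, -, rfl⟩ := Finset.mem_image.1 hz
        exact ⟨j, fun p _ => hs_min j p⟩
      · refine ⟨i₀, fun p hp => ?_⟩
        rcases Finset.mem_insert.1 hp with rfl | hp
        · exact hxmax z (by simpa using hz)
        · obtain ⟨j, hj, rfl⟩ := Finset.mem_image.1 hp
          by_cases hzs : z ∈ Set.range s
          · obtain ⟨k, rfl⟩ := hzs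
            have : k = i₀ := by
              by_contra hk
              exact (hnot _).1 hz k hk rfl
            rw [this]
            exact hs_min _ _
          · exact (hs_max i₀ j z (Finset.ne_of_mem_erase hj) hzs).le
  -- the doors of a room
  have habove : ∀ P ∈ rooms, Even (Finset.bipartiteAbove (fun P τ => τ ⊆ P) doors P).card := by
    intro P hP
    obtain ⟨hPd, hPc⟩ := (hrooms P).1 hP
    have hmem : ∀ τ, τ ∈ Finset.bipartiteAbove (fun P τ => τ ⊆ P) doors P ↔
        ∃ p ∈ P, τ = P.erase p ∧ (P.erase p).image c = Finset.univ.erase i₀ := by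
      intro τ
      rw [Finset.mem_bipartiteAbove, hdoors]
      constructor
      · rintro ⟨⟨h1, h2⟩, h3⟩
        obtain ⟨p, hp⟩ : ∃ p, P \ τ = {p} := by
          rw [← Finset.card_eq_one, Finset.card_sdiff_of_subset h3]
          omega
        have hpm : p ∈ P \ τ := hp ▸ Finset.mem_singleton_self p
        have : τ = P.erase p := by
          rw [← Finset.sdiff_singleton_eq_erase, ← hp, Finset.sdiff_sdiff_eq_self h3]
        exact ⟨p, (Finset.mem_sdiff.1 hpm).1, this, this ▸ h1⟩
      · rintro ⟨p, hp, rfl, h⟩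
        exact ⟨⟨h, by rw [Finset.card_erase_add_one hp, hPc]⟩, Finset.erase_subset _ _⟩
    rcases Finset.eq_empty_or_nonempty (Finset.bipartiteAbove (fun P τ => τ ⊆ P) doors P)
      with h0 | ⟨τ, hτ⟩
    · simp [h0]
    · obtain ⟨p, hp, rfl, hpc⟩ := (hmem τ).1 hτ
      have hinj : Set.InjOn c (P.erase p) := by
        rw [← Finset.card_image_iff, hpc]
        have := Finset.card_erase_add_one hp
        omega
      have hcp : c p ∈ Finset.univ.erase i₀ := by
        rw [Finset.mem_erase]
        refine ⟨fun h => hcon P hPd ?_, Finset.mem_univ _⟩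
        rw [← Finset.insert_erase hp, Finset.image_insert, hpc, h,
          Finset.insert_erase (Finset.mem_univ _)]
      rw [← hpc] at hcp
      -- The colour `i₀` is missing from the room, so the removed `p` repeats the colour of a unique
      -- `q`; exchanging `p` and `q` gives the only other door.
      obtain ⟨q, hq, hqp⟩ := Finset.mem_image.1 hcp
      have hqP := Finset.mem_of_mem_erase hq
      have hqne := Finset.ne_of_mem_erase hq
      have : Finset.bipartiteAbove (fun P τ => τ ⊆ P) doors P = {P.erase p, P.erase q} := by
        ext τ
        rw [hmem, Finset.mem_insert, Finset.mem_singleton]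
        constructor
        · rintro ⟨w, hw, rfl, hwc⟩
          by_cases hwp : w = p
          · exact Or.inl (by rw [hwp])
          right
          have hcw : c w ∈ (P.erase w).image c := by
            rw [hwc, ← hpc]
            exact Finset.mem_image_of_mem _ (Finset.mem_erase.2 ⟨hwp, hw⟩)
          obtain ⟨v, hv, hvw⟩ := Finset.mem_image.1 hcw
          by_cases hvp : v = p
          · rw [hinj (Finset.mem_erase.2 ⟨hwp, hw⟩) hq (by rw [hqp, ← hvw, hvp])]
          · exact absurd (hinj (Finset.mem_erase.2 ⟨hvp, Finset.mem_of_mem_erase hv⟩)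
              (Finset.mem_erase.2 ⟨hwp, hw⟩) hvw) (Finset.ne_of_mem_erase hv)
        · rintro (rfl | rfl)
          · exact ⟨p, hp, rfl, hpc⟩
          · refine ⟨q, hqP, rfl, ?_⟩
            rw [← hpc]
            ext i
            simp only [Finset.mem_image, Finset.mem_erase]
            constructor
            · rintro ⟨a, ⟨ha, haP⟩, rfl⟩
              by_cases hap : a = p
              · exact ⟨q, ⟨hqne, hqP⟩, by rw [hqp, hap]⟩
              · exact ⟨a, ⟨hap, haP⟩, rfl⟩
            · rintro ⟨a, ⟨ha, haP⟩, rfl⟩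
              by_cases haq : a = q
              · exact ⟨p, ⟨hqne.symm, hp⟩, by rw [haq, hqp]⟩
              · exact ⟨a, ⟨haq, haP⟩, rfl⟩
      rw [this, Finset.card_pair]
      · exact even_two
      · intro h
        have : q ∈ P.erase q := h ▸ hq
        exact absurd rfl (Finset.ne_of_mem_erase this)
  have hev : Even (∑ P ∈ rooms, (Finset.bipartiteAbove (fun P τ => τ ⊆ P) doors P).card) :=
    Finset.even_sum _ habove
  rw [hdc, ← Finset.add_sum_erase _ _ hτ₀, houter] at hev
  have hev' : Even (∑ τ ∈ doors.erase τ₀,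
      (Finset.bipartiteBelow (fun P τ => τ ⊆ P) rooms τ).card) :=
    Finset.even_sum _ fun τ hτ =>
      hinner τ (Finset.mem_of_mem_erase hτ) (Finset.ne_of_mem_erase hτ)
  rcases hev with ⟨a, ha⟩
  rcases hev' with ⟨b, hb⟩
  omega

end Scarf

/-! ### Grid colourings and Brouwer's theorem for a simplex -/

/-- A colouring of the points with natural coordinates of the simplex `∑ i, t i = N` has points of
colour `i`, for every `i`, near a common point, except for those `i` whose coordinate is small. -/
theorem exists_forall_exists_color_eq_or_le {I : Type*} [Fintype I] [Nonempty I] (N : ℕ)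
    (c : (I → ℕ) → I) :
    ∃ t₀ : I → ℕ, ∑ i, t₀ i = N ∧ ∀ i, ∃ t : I → ℕ, ∑ j, t j = N ∧
      (∀ j, t j ≤ t₀ j + Fintype.card I ∧ t₀ j ≤ t j + Fintype.card I) ∧
      (c t = i ∨ t i ≤ Fintype.card I) := by
  classical
  let T := {t : I → Fin (N + 1) // ∑ i, (t i : ℕ) = N}
  let v : T → I → ℕ := fun t i => t.1 i
  have hv : ∀ t : T, ∑ i, v t i = N := fun t => t.2
  have hvN : ∀ (t : T) i, v t i ≤ N := fun t i => Nat.lt_succ_iff.1 (t.1 i).2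
  have hmk : ∀ y : I → ℕ, ∑ i, y i = N → ∃ t : T, v t = y := by
    intro y hy
    have hle : ∀ i, y i < N + 1 := fun i => by
      have := Finset.single_le_sum (f := y) (fun _ _ => Nat.zero_le _) (Finset.mem_univ i)
      omega
    exact ⟨⟨fun i => ⟨y i, hle i⟩, hy⟩, rfl⟩
  -- every family of coordinates of sum at most `N` is below a point of the grid
  have hext : ∀ y : I → ℕ, ∑ i, y i ≤ N → ∃ t : T, ∀ i, y i ≤ v t i := by
    intro y hy
    obtain ⟨i₀⟩ := ‹Nonempty I›
    obtain ⟨t, ht⟩ := hmk (y + Pi.single i₀ (N - ∑ i, y i)) (by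
      simp only [Pi.add_apply, Finset.sum_add_distrib, Finset.sum_pi_single', Finset.mem_univ,
        if_true]
      omega)
    exact ⟨t, fun i => by rw [ht]; exact Nat.le_add_right _ _⟩
  let M := Fintype.card T
  let e := Fintype.equivFin T
  let e' := Fintype.equivFin I
  -- Grid points are ranked by their `i`-th coordinate, with ties broken by `e`. The artificial
  -- element `i` comes strictly below them (hence the `+ 1`), and the other artificial elements come
  -- above, kept distinct by `e'`.
  let r : I → T ⊕ I → ℕ := fun i a => Sum.elim (fun t => v t i * M + e t + 1)
    (fun j => if j = i then 0 else (N + 1) * M + 1 + e' j) a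
  have hr_l : ∀ i t, r i (Sum.inl t) = v t i * M + e t + 1 := fun _ _ => rfl
  have hr_r : ∀ i j, r i (Sum.inr j) = if j = i then 0 else (N + 1) * M + 1 + e' j :=
    fun _ _ => rfl
  have heM : ∀ t, (e t : ℕ) < M := fun t => (e t).2
  have hlt : ∀ {i t t'}, v t i < v t' i → r i (Sum.inl t) < r i (Sum.inl t') := by
    intro i t t' h
    have h1 : (v t i + 1) * M ≤ v t' i * M := Nat.mul_le_mul_right _ h
    have := heM t
    rw [hr_l, hr_l]
    rw [add_mul] at h1
    omega
  have hl_lt : ∀ i t, r i (Sum.inl t) < (N + 1) * M + 1 := by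
    intro i t
    have h1 : v t i * M ≤ N * M := Nat.mul_le_mul_right _ (hvN t i)
    have := heM t
    rw [hr_l, add_mul]
    omega
  have hr : ∀ i, Function.Injective (r i) := by
    rintro i (t | j) (t' | j') h
    · rcases lt_trichotomy (v t i) (v t' i) with h' | h' | h'
      · exact absurd h (hlt h').ne
      · rw [hr_l, hr_l, h'] at h
        have : e t = e t' := Fin.ext (by omega)
        rw [e.injective this]
      · exact absurd h (hlt h').ne'
    · have h1 := hl_lt i t
      rw [h, hr_r] at h1
      rw [hr_r, hr_l] at h
      split_ifs at h h1; omega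
    · have h1 := hl_lt i t'
      rw [← h, hr_r] at h1
      rw [hr_r, hr_l] at h
      split_ifs at h h1; omega
    · rw [hr_r, hr_r] at h
      split_ifs at h with h1 h2 h2
      · rw [h1, h2]
      · omega
      · omega
      · have : e' j = e' j' := Fin.ext (by omega)
        rw [e'.injective this]
  obtain ⟨t₁, -⟩ := hext 0 (by simp)
  obtain ⟨P, hP, hPc⟩ := exists_isDominant_image_eq_univ hr Sum.inr Sum.inr_injective
    (fun i a => by rw [hr_r, if_pos rfl]; exact Nat.zero_le _)
    (by
      rintro i j (t | k) hj ha
      · rw [hr_r, if_neg hj]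
        exact (hl_lt i t).trans_le (Nat.le_add_right _ _)
      · exact absurd ⟨k, rfl⟩ ha)
    (Sum.elim (fun t => c (v t)) id) (fun i => rfl) ⟨Sum.inl t₁, by simp⟩
  have hcol : ∀ i, Sum.inr i ∉ P → ∃ t, Sum.inl t ∈ P ∧ c (v t) = i := by
    intro i hi
    have : i ∈ P.image (Sum.elim (fun t => c (v t)) id) := hPc ▸ Finset.mem_univ i
    obtain ⟨a | j, ha, hai⟩ := Finset.mem_image.1 this
    · exact ⟨a, ha, hai⟩
    · obtain rfl : j = i := hai
      exact absurd ha hi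
  obtain ⟨t₀, ht₀⟩ : ∃ t₀, Sum.inl t₀ ∈ P := by
    obtain ⟨i, hi⟩ := hP (Sum.inl t₁)
    obtain ⟨t, ht, -⟩ := hcol i fun h => by
      have := hi _ h
      rw [hr_r, if_pos rfl, hr_l] at this
      omega
    exact ⟨t, ht⟩
  have hmin : ∀ i, ∃ t, Sum.inl t ∈ P ∧ ∀ t', Sum.inl t' ∈ P → v t i ≤ v t' i := by
    intro i
    obtain ⟨t, ht, htm⟩ := Finset.exists_min_image (Finset.univ.filter fun t => Sum.inl t ∈ P)
      (fun t => v t i) ⟨t₀, by simpa using ht₀⟩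
    exact ⟨t, by simpa using ht, fun t' ht' => htm t' (by simpa using ht')⟩
  choose w hwP hw using hmin
  -- The minimal coordinates over `P`, where an artificial element counts as coordinate zero.
  let m : I → ℕ := fun i => if Sum.inr i ∈ P then 0 else v (w i) i
  have hm_le : ∀ i t, Sum.inl t ∈ P → m i ≤ v t i := by
    intro i t ht
    dsimp only [m]
    split_ifs
    · exact Nat.zero_le _
    · exact hw i t ht
  -- Otherwise the coordinates could be raised above all the minima at some grid point, against
  -- dominance. As the minima nearly exhaust the total `N`, no coordinate on `P` can exceed its
  -- minimum by more than the number of colours.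
  have hsum : N < ∑ i, m i + Fintype.card I := by
    by_contra! hcon
    obtain ⟨t, ht⟩ := hext (fun i => if Sum.inr i ∈ P then 0 else v (w i) i + 1) (by
      refine le_trans ?_ hcon
      rw [← Finset.card_univ, Finset.card_eq_sum_ones, ← Finset.sum_add_distrib]
      refine Finset.sum_le_sum fun i _ => ?_
      dsimp only [m]
      split_ifs <;> omega)
    obtain ⟨i, hi⟩ := hP (Sum.inl t)
    by_cases hiP : Sum.inr i ∈ P
    · have := hi _ hiP
      rw [hr_r, if_pos rfl, hr_l] at this
      omega
    · have h1 := ht i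
      rw [if_neg hiP] at h1
      exact absurd (hi _ (hwP i)) (not_le.2 (hlt (by omega)))
  have hle_m : ∀ i t, Sum.inl t ∈ P → v t i ≤ m i + Fintype.card I := by
    intro i t ht
    have h1 : v t i + ∑ j ∈ Finset.univ.erase i, v t j = N := by
      rw [Finset.add_sum_erase _ _ (Finset.mem_univ i), hv]
    have h2 : m i + ∑ j ∈ Finset.univ.erase i, m j = ∑ j, m j :=
      Finset.add_sum_erase _ _ (Finset.mem_univ i)
    have h3 : ∑ j ∈ Finset.univ.erase i, m j ≤ ∑ j ∈ Finset.univ.erase i, v t j :=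
      Finset.sum_le_sum fun j _ => hm_le j t ht
    omega
  refine ⟨v t₀, hv t₀, fun i => ?_⟩
  have hnear : ∀ t, Sum.inl t ∈ P → ∀ j, v t j ≤ v t₀ j + Fintype.card I ∧
      v t₀ j ≤ v t j + Fintype.card I := by
    intro t ht j
    have h1 := hm_le j t ht
    have h2 := hm_le j t₀ ht₀
    have h3 := hle_m j t ht
    have h4 := hle_m j t₀ ht₀
    omega
  by_cases hi : Sum.inr i ∈ P
  · refine ⟨v t₀, hv t₀, hnear t₀ ht₀, Or.inr ?_⟩
    have := hle_m i t₀ ht₀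
    simpa [m, hi] using this
  · obtain ⟨t, ht, htc⟩ := hcol i hi
    exact ⟨v t, hv t, hnear t ht, Or.inl htc⟩

/-- **Brouwer's fixed point theorem** for the standard simplex. -/
theorem exists_fixedPoint_stdSimplex {I : Type*} [Fintype I] [Nonempty I]
    {f : (I → ℝ) → I → ℝ} (hf : ContinuousOn f (stdSimplex ℝ I))
    (hmaps : Set.MapsTo f (stdSimplex ℝ I) (stdSimplex ℝ I)) :
    ∃ x ∈ stdSimplex ℝ I, f x = x := by
  classical
  -- A grid point gets a colour `i` whose coordinate `f` does not decrease; one exists because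
  -- coordinates sum to one before and after. The exceptional small coordinates fit the same
  -- estimate, as `f` has nonnegative coordinates. In the limit `a i ≤ f a i` for all `i`, and
  -- equality of the sums forces `f a = a`.
  have happrox : ∀ N : ℕ, ∃ x ∈ stdSimplex ℝ I, ∃ z : I → I → ℝ, ∀ i, z i ∈ stdSimplex ℝ I ∧
      dist (z i) x ≤ Fintype.card I / ((N : ℝ) + 1) ∧
      z i i ≤ f (z i) i + Fintype.card I / ((N : ℝ) + 1) := by
    intro N
    have hN : (0 : ℝ) < (N : ℝ) + 1 := by positivity
    let p : (I → ℕ) → I → ℝ := fun t i => t i / ((N : ℝ) + 1)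
    have hp : ∀ t : I → ℕ, ∑ i, t i = N + 1 → p t ∈ stdSimplex ℝ I := by
      intro t ht
      refine ⟨fun i => by positivity, ?_⟩
      rw [← Finset.sum_div, ← Nat.cast_sum, ht]
      push_cast
      exact div_self hN.ne'
    have hcol : ∀ t : I → ℕ, ∃ i, ∑ i, t i = N + 1 → p t i ≤ f (p t) i := by
      intro t
      by_cases ht : ∑ i, t i = N + 1
      · by_contra! hcon
        have : ∑ i, f (p t) i < ∑ i, p t i :=
          Finset.sum_lt_sum_of_nonempty Finset.univ_nonempty fun i _ => (hcon i).2
        rw [(hp t ht).2, (hmaps (hp t ht)).2] at this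
        exact lt_irrefl _ this
      · exact ⟨Classical.arbitrary I, fun h => absurd h ht⟩
    choose c hc using hcol
    obtain ⟨t₀, ht₀, h⟩ := exists_forall_exists_color_eq_or_le (N + 1) c
    choose t ht hnear hct using h
    refine ⟨p t₀, hp t₀ ht₀, fun i => p (t i), fun i => ⟨hp _ (ht i), ?_, ?_⟩⟩
    · rw [dist_pi_le_iff (by positivity)]
      intro j
      obtain ⟨h1, h2⟩ := hnear i j
      have h1' : (t i j : ℝ) ≤ t₀ j + Fintype.card I := by exact_mod_cast h1
      have h2' : (t₀ j : ℝ) ≤ t i j + Fintype.card I := by exact_mod_cast h2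
      rw [Real.dist_eq, ← sub_div, abs_div, abs_of_pos hN]
      gcongr
      rw [abs_le]
      constructor <;> linarith
    · rcases hct i with h | h
      · have h1 := hc (t i) (ht i)
        rw [h] at h1
        have : (0 : ℝ) ≤ Fintype.card I / ((N : ℝ) + 1) := by positivity
        linarith
      · have h1 := (hmaps (hp _ (ht i))).1 i
        have : p (t i) i ≤ Fintype.card I / ((N : ℝ) + 1) := by
          dsimp only [p]
          gcongr
        linarith
  choose x hx z hz using happrox
  obtain ⟨a, ha, φ, hφ, hlim⟩ := (isCompact_stdSimplex ℝ I).tendsto_subseq hx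
  have hε : Tendsto (fun N : ℕ => (Fintype.card I : ℝ) / (((φ N : ℕ) : ℝ) + 1)) atTop (𝓝 0) := by
    have h1 : Tendsto (fun N : ℕ => (N : ℝ) + 1) atTop atTop :=
      tendsto_atTop_add_const_right _ _ tendsto_natCast_atTop_atTop
    exact (h1.const_div_atTop _).comp hφ.tendsto_atTop
  have hzlim : ∀ i, Tendsto (fun N => z (φ N) i) atTop (𝓝 a) := by
    intro i
    refine hlim.congr_dist ?_
    refine squeeze_zero (fun _ => dist_nonneg) (fun N => ?_) hε
    rw [dist_comm]
    exact (hz (φ N) i).2.1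
  have hle : ∀ i, a i ≤ f a i := by
    intro i
    have h1 : Tendsto (fun N => f (z (φ N) i)) atTop (𝓝 (f a)) :=
      (hf a ha).tendsto.comp (tendsto_nhdsWithin_iff.2
        ⟨hzlim i, Eventually.of_forall fun N => (hz (φ N) i).1⟩)
    have h2 := ((tendsto_pi_nhds.1 h1) i).add hε
    rw [add_zero] at h2
    exact le_of_tendsto_of_tendsto ((tendsto_pi_nhds.1 (hzlim i)) i) h2
      (Eventually.of_forall fun N => (hz (φ N) i).2.2)
  refine ⟨a, ha, funext fun i => ?_⟩
  have hsum : ∑ i, a i = ∑ i, f a i := by rw [ha.2, (hmaps ha).2]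
  exact ((Finset.sum_eq_sum_iff_of_le fun i _ => hle i).1 hsum i (Finset.mem_univ i)).symm

/-! ### Brouwer and KKM for products of simplices -/

section Simplotope

variable {ι : Type*} [Fintype ι] {K : ι → Type*} [∀ i, Fintype (K i)] [∀ i, Nonempty (K i)]

/-- Brouwer's fixed point theorem for a product of standard simplices. -/
theorem exists_fixedPoint_pi_stdSimplex {T : (∀ i, K i → ℝ) → ∀ i, K i → ℝ}
    (hT : ContinuousOn T (Set.univ.pi fun i => stdSimplex ℝ (K i)))
    (hmaps : Set.MapsTo T (Set.univ.pi fun i => stdSimplex ℝ (K i))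
      (Set.univ.pi fun i => stdSimplex ℝ (K i))) :
    ∃ x ∈ Set.univ.pi fun i => stdSimplex ℝ (K i), T x = x := by
  classical
  cases isEmpty_or_nonempty ι with
  | inl h => exact ⟨fun i => h.elim i, fun i => h.elim i, funext fun i => h.elim i⟩
  | inr h =>
  let n : ℝ := Fintype.card ι
  have hn : 0 < n := Nat.cast_pos.2 Fintype.card_pos
  let b : ((Σ i, K i) → ℝ) → ι → ℝ := fun z i => ∑ k, z ⟨i, k⟩
  -- a retraction of the simplex on the disjoint union to the product of the simplices
  let ρ : ((Σ i, K i) → ℝ) → ∀ i, K i → ℝ := fun z i k =>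
    (z ⟨i, k⟩ + max (1 / n - b z i) 0 / Fintype.card (K i)) / max (b z i) (1 / n)
  -- A block of weight below `1 / n` has its deficit spread evenly before normalisation, so the
  -- denominators stay away from zero even on empty blocks.
  have hden : ∀ z i, 0 < max (b z i) (1 / n) := fun z i =>
    lt_max_of_lt_right (by positivity)
  have hρ : ∀ z ∈ stdSimplex ℝ (Σ i, K i), ρ z ∈ Set.univ.pi fun i => stdSimplex ℝ (K i) := by
    intro z hz i _
    refine ⟨fun k => ?_, ?_⟩
    · have := hz.1 ⟨i, k⟩
      have := (hden z i).le
      dsimp only [ρ]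
      positivity
    · have hK : (Fintype.card (K i) : ℝ) ≠ 0 := Nat.cast_ne_zero.2 Fintype.card_ne_zero
      dsimp only [ρ]
      rw [← Finset.sum_div, Finset.sum_add_distrib, Finset.sum_const, Finset.card_univ,
        nsmul_eq_mul, mul_div_cancel₀ _ hK, div_eq_one_iff_eq (hden z i).ne']
      change b z i + _ = _
      rcases le_total (b z i) (1 / n) with h | h
      · rw [max_eq_left (by linarith), max_eq_right h]
        ring
      · rw [max_eq_right (by linarith), max_eq_left h]
        ring
  have hρc : Continuous ρ := by
    refine continuous_pi fun i => continuous_pi fun k => ?_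
    have hb : Continuous fun z => b z i := by
      dsimp only [b]
      fun_prop
    refine Continuous.div ?_ (hb.max continuous_const) fun z => (hden z i).ne'
    exact (continuous_apply _).add
      (((continuous_const.sub hb).max continuous_const).div_const _)
  have : Nonempty (Σ i, K i) := h.map fun i => ⟨i, Classical.arbitrary _⟩
  obtain ⟨z, hz, hfix⟩ := exists_fixedPoint_stdSimplex
    (f := fun z (j : Σ i, K i) => T (ρ z) j.1 j.2 / n)
    (by
      refine continuousOn_pi.2 fun j => ContinuousOn.div_const ?_ _
      exact continuousOn_pi.1 (continuousOn_pi.1 (hT.comp hρc.continuousOn hρ) j.1) j.2)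
    (by
      intro z hz
      have hTz := hmaps (hρ z hz)
      refine ⟨fun j => div_nonneg ((hTz j.1 trivial).1 j.2) hn.le, ?_⟩
      rw [Fintype.sum_sigma]
      simp only [← Finset.sum_div]
      rw [Finset.sum_congr rfl fun i _ => (hTz i trivial).2, Finset.sum_const, Finset.card_univ,
        nsmul_eq_mul, mul_one]
      exact div_self hn.ne')
  have hzT : ∀ i k, z ⟨i, k⟩ = T (ρ z) i k / n := fun i k => (congrFun hfix ⟨i, k⟩).symm
  -- At the fixed point every block has weight exactly `1 / n`, so there `ρ` merely multiplies by
  -- `n`, undoing the division in the map.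
  have hbz : ∀ i, b z i = 1 / n := by
    intro i
    dsimp only [b]
    simp only [hzT]
    rw [← Finset.sum_div, (hmaps (hρ z hz) i trivial).2]
  refine ⟨ρ z, hρ z hz, funext fun i => funext fun k => ?_⟩
  have : ρ z i k = (z ⟨i, k⟩ + max (1 / n - b z i) 0 / Fintype.card (K i)) /
    max (b z i) (1 / n) := rfl
  rw [this, hbz, hzT]
  simp [hn.ne']

/-- A Knaster–Kuratowski–Mazurkiewicz lemma for products of simplices. -/
theorem exists_forall_mem_of_forall_exists_pos {G : ∀ i, K i → Set (∀ i, K i → ℝ)}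
    (hG : ∀ i k, IsClosed (G i k))
    (hcov : ∀ x ∈ Set.univ.pi fun i => stdSimplex ℝ (K i), ∀ i, ∃ k, 0 < x i k ∧ x ∈ G i k) :
    ∃ x ∈ Set.univ.pi fun i => stdSimplex ℝ (K i), ∀ i k, x ∈ G i k := by
  classical
  -- At a point whose `i`-th component is the vertex `k`, the covering condition leaves no other
  -- choice. Nonemptiness matters because `Metric.infDist` to the empty set is zero.
  have hne : ∀ i k, (G i k).Nonempty := by
    intro i k
    let x : ∀ i, K i → ℝ := fun j =>
      if h : j = i then Pi.single (h ▸ k) 1 else Pi.single (Classical.arbitrary _) 1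
    obtain ⟨k', hk', hx⟩ := hcov x (fun j _ => by
      dsimp only [x]
      split_ifs <;> exact single_mem_stdSimplex ℝ _) i
    have : k' = k := by
      by_contra hne
      simp [x, hne] at hk'
    exact ⟨x, this ▸ hx⟩
  -- As in Nash's argument, weight is moved towards the indices whose sets are far away. At a fixed
  -- point `g x i l` is `x i l` times the total distance; an index of positive weight and distance
  -- zero makes that total vanish.
  let g : (∀ i, K i → ℝ) → ∀ i, K i → ℝ := fun x i k => Metric.infDist x (G i k)
  have hg0 : ∀ x i k, 0 ≤ g x i k := fun x i k => Metric.infDist_nonneg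
  have hgc : ∀ i k, Continuous fun x => g x i k := fun i k => Metric.continuous_infDist_pt _
  have hs : ∀ x i, 0 < 1 + ∑ k, g x i k := fun x i =>
    add_pos_of_pos_of_nonneg one_pos (Finset.sum_nonneg fun k _ => hg0 x i k)
  obtain ⟨x, hx, hfix⟩ := exists_fixedPoint_pi_stdSimplex
    (T := fun x i k => (x i k + g x i k) / (1 + ∑ l, g x i l))
    (by
      refine Continuous.continuousOn (continuous_pi fun i => continuous_pi fun k => ?_)
      refine Continuous.div ?_ ?_ fun x => (hs x i).ne'
      · have hxc : Continuous fun x : ∀ i, K i → ℝ => x i k := by fun_prop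
        exact hxc.add (hgc i k)
      · exact continuous_const.add (continuous_finsetSum _ fun l _ => hgc i l))
    (by
      intro x hx i _
      refine ⟨fun k => div_nonneg (add_nonneg ((hx i trivial).1 k) (hg0 x i k)) (hs x i).le, ?_⟩
      rw [← Finset.sum_div, Finset.sum_add_distrib, (hx i trivial).2, div_self (hs x i).ne'])
  refine ⟨x, hx, fun i => ?_⟩
  obtain ⟨k, hk, hxk⟩ := hcov x hx i
  have hfix' : ∀ l, x i l * ∑ l, g x i l = g x i l := by
    intro l
    have := congrFun (congrFun hfix i) l
    rw [div_eq_iff (hs x i).ne'] at this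
    linarith
  have hgk : g x i k = 0 := Metric.infDist_zero_of_mem hxk
  have hsum : ∑ l, g x i l = 0 := by
    have := hfix' k
    rw [hgk] at this
    exact (mul_eq_zero.1 this).resolve_left hk.ne'
  intro l
  rw [(hG i l).mem_iff_infDist_zero (hne i l)]
  change g x i l = 0
  rw [← hfix' l, hsum, mul_zero]

end Simplotope

/-! ### Semicontinuity, self segment-density and convexity on nonconvex sets -/

/-- The set where a lower semicontinuous function is at most an upper semicontinuous function is
closed. -/
theorem isClosed_setOf_le_of_semicontinuousOn {X : Type*} [TopologicalSpace X] {s : Set X}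
    (hs : IsClosed s) {f g : X → ℝ} (hf : LowerSemicontinuousOn f s)
    (hg : UpperSemicontinuousOn g s) : IsClosed {x | x ∈ s ∧ f x ≤ g x} := by
  refine isClosed_of_closure_subset fun x hx => ?_
  have hxs : x ∈ s := hs.closure_subset_iff.2 (fun _ h => h.1) hx
  refine ⟨hxs, ?_⟩
  by_contra! hlt
  obtain ⟨c, hgc, hcf⟩ := exists_between hlt
  have h := eventually_nhdsWithin_iff.1 ((hf x hxs c hcf).and (hg x hxs c hgc))
  obtain ⟨y, hy, hys⟩ := ((mem_closure_iff_frequently.1 hx).and_eventually h).exists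
  have := hys hy.1
  linarith [hy.2]

namespace SelfSegmentDense

/-- The convex hull of finitely many points of a self segment-dense set `U` meets `U` in a dense
set. -/
theorem IsSelfSegmentDense.convexHull_subset_closure {X : Type*} [AddCommGroup X] [Module ℝ X]
    [TopologicalSpace X] [ContinuousAdd X] [ContinuousSMul ℝ X] {U V : Set X}
    (hU : IsSelfSegmentDense U V) {F : Set X} (hF : F.Finite) (hFU : F ⊆ U) :
    convexHull ℝ F ⊆ closure (convexHull ℝ F ∩ U) := by
  induction F, hF using Set.Finite.induction_on with
  | empty => simp
  | @insert a F _ _ ih =>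
    have haU : a ∈ U := hFU (Set.mem_insert _ _)
    rcases F.eq_empty_or_nonempty with rfl | hne
    · simpa using subset_closure (show a ∈ {a} ∩ U from ⟨rfl, haU⟩)
    intro p hp
    rw [convexHull_insert hne, mem_convexJoin] at hp
    obtain ⟨_, rfl, w, hw, α, β, hα, hβ, hαβ, rfl⟩ := hp
    have hcl := ih ((Set.subset_insert _ _).trans hFU) hw
    -- Two successive approximations: `w` by points `v` of `U` in the smaller hull, then the point
    -- of the segment from the new vertex to `v` by points of `U`, both endpoints now being in `U`.
    rw [← closure_closure (s := convexHull ℝ _ ∩ U)]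
    refine map_mem_closure (f := fun w => α • _ + β • w) (by fun_prop) hcl ?_
    rintro v ⟨hv, hvU⟩
    refine closure_mono ?_ (hU.segment_dense _ haU v hvU ⟨α, β, hα, hβ, hαβ, rfl⟩)
    refine Set.inter_subset_inter_left _ ((convex_convexHull ℝ _).segment_subset ?_ ?_)
    · exact subset_convexHull ℝ _ (Set.mem_insert _ _)
    · exact convexHull_mono (Set.subset_insert _ _) hv

/-- A function that is convex on a set is bounded, at a point of the convex hull of a subset, by
one of its values on the subset. -/
theorem IsConvexOnSet.exists_le {X : Type*} [AddCommGroup X] [Module ℝ X] {K s : Set X}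
    {g : X → ℝ} (hg : IsConvexOnSet K g) (hs : s ⊆ K) {x : X} (hx : x ∈ convexHull ℝ s)
    (hxK : x ∈ K) : ∃ y ∈ s, g x ≤ g y := by
  obtain ⟨κ, _, w, z, hw0, hw1, hz, rfl⟩ := mem_convexHull_iff_exists_fintype.1 hx
  let e := (Fintype.equivFin κ).symm
  have hsum : ∑ k, w (e k) • z (e k) = ∑ k, w k • z k := e.sum_comp fun k => w k • z k
  have h := hg _ (z ∘ e) (w ∘ e) (fun k => hs (hz _)) (fun k => hw0 _)
    ((e.sum_comp w).trans hw1) (by simpa only [Function.comp_apply, hsum] using hxK)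
  simp only [Function.comp_apply, hsum, e.sum_comp fun k => w k * g (z k)] at h
  by_contra! hcon
  have hle : ∀ k, w k * g (z k) ≤ w k * g (∑ k, w k • z k) := fun k =>
    mul_le_mul_of_nonneg_left (hcon _ (hz k)).le (hw0 k)
  have hpos : ∃ k, 0 < w k := by
    by_contra! hle0
    have : ∑ k, w k ≤ 0 := Finset.sum_nonpos fun k _ => hle0 k
    linarith
  obtain ⟨k, hk⟩ := hpos
  have hlt : ∑ k, w k * g (z k) < ∑ k, w k * g (∑ k, w k • z k) :=
    Finset.sum_lt_sum (fun k _ => hle k)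
      ⟨k, Finset.mem_univ _, mul_lt_mul_of_pos_left (hcon _ (hz k)) hk⟩
  rw [← Finset.sum_mul, hw1, one_mul] at hlt
  exact absurd h (not_le.2 hlt)

/-! ### Finitely many deviations -/

section Game

variable {n : ℕ} {X : Fin n → Type*}

theorem profile_eta (i : Fin n) (x : ∀ j, X j) : profile i (x i) (others i x) = x :=
  (Equiv.piSplitAt i X).symm_apply_apply x

theorem continuous_others [∀ i, TopologicalSpace (X i)] (i : Fin n) :
    Continuous (others (X := X) i) :=
  continuous_pi fun j => continuous_apply j.1

theorem others_mem {E : ∀ j, Set (X j)} {x : ∀ j, X j} (hx : x ∈ multistrategies E) (i : Fin n) :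
    others i x ∈ othersSet E i :=
  fun j => hx j

theorem multistrategies_eq_pi (E : ∀ j, Set (X j)) : multistrategies E = Set.univ.pi E := by
  ext x
  simp [multistrategies]

variable [∀ i, AddCommGroup (X i)] [∀ i, Module ℝ (X i)] [∀ i, TopologicalSpace (X i)]
  [∀ i, IsTopologicalAddGroup (X i)] [∀ i, ContinuousSMul ℝ (X i)]
  {E D : ∀ i, Set (X i)} {f : Fin n → (∀ j, X j) → ℝ}

/-- If each player has finitely many alternatives, in a self segment-dense set, then some
multistrategy cannot be improved by any of them. -/
theorem exists_forall_finset_le (hE_convex : ∀ i, Convex ℝ (E i))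
    (hD : ∀ i, IsSelfSegmentDense (D i) (E i))
    (h_convex : ∀ i, ∀ z ∈ othersSet D i, IsConvexOnSet (D i) fun y => f i (profile i y z))
    (hclosed : ∀ i, ∀ y ∈ D i,
      IsClosed {x | x ∈ multistrategies E ∧ f i x ≤ f i (profile i y (others i x))})
    (F : ∀ i, Finset (X i)) (hF : ∀ i, (F i).Nonempty) (hFD : ∀ i, ↑(F i) ⊆ D i) :
    ∃ x ∈ multistrategies E, ∀ i, ∀ y ∈ F i, f i x ≤ f i (profile i y (others i x)) := by
  classical
  have : ∀ i, Nonempty (F i) := fun i => (hF i).to_subtype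
  let ψ : (∀ i, F i → ℝ) → ∀ i, X i := fun x i => ∑ k, x i k • (k : X i)
  have hψ : Continuous ψ := by
    refine continuous_pi fun i => continuous_finsetSum _ fun k _ => ?_
    have hxc : Continuous fun x : ∀ i, F i → ℝ => x i k := by fun_prop
    exact hxc.smul continuous_const
  obtain ⟨x, hx, hxG⟩ := exists_forall_mem_of_forall_exists_pos
    (G := fun i (k : F i) => ψ ⁻¹'
      {x | x ∈ multistrategies E ∧ f i x ≤ f i (profile i k (others i x))})
    (fun i k => (hclosed i k (hFD i k.2)).preimage hψ) (by
      intro x hx i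
      -- the alternatives of positive weight
      let S : ∀ j, Set (X j) := fun j => (fun k : F j => (k : X j)) '' {k | 0 < x j k}
      have hSfin : ∀ j, (S j).Finite := fun j => (Set.toFinite _).image _
      have hSD : ∀ j, S j ⊆ D j := by
        rintro j _ ⟨k, -, rfl⟩
        exact hFD j k.2
      -- Approximating inside the hulls of the alternatives in use, rather than of all of `F j`,
      -- ensures that the alternative which Jensen's inequality provides at each approximant has
      -- positive weight at `x` itself.
      have hmem : ψ x ∈ closure (Set.univ.pi fun j => convexHull ℝ (S j) ∩ D j) := by
        rw [closure_pi_set]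
        intro j _
        apply (hD j).convexHull_subset_closure (hSfin j) (hSD j)
        have h1 : ∑ k ∈ Finset.univ.filter (fun k => 0 < x j k), x j k = 1 := by
          rw [← (hx j trivial).2]
          refine Finset.sum_subset (Finset.filter_subset _ _) fun k _ hk => ?_
          exact le_antisymm (by simpa using hk) ((hx j trivial).1 k)
        have h2 : ψ x j = ∑ k ∈ Finset.univ.filter (fun k => 0 < x j k), x j k • (k : X j) := by
          refine (Finset.sum_subset (Finset.filter_subset _ _) fun k _ hk => ?_).symm
          rw [le_antisymm (by simpa using hk) ((hx j trivial).1 k), zero_smul]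
        rw [h2]
        refine (convex_convexHull ℝ (S j)).sum_mem (fun k _ => (hx j trivial).1 k) h1 ?_
        intro k hk
        exact subset_convexHull ℝ _ ⟨k, by simpa using hk, rfl⟩
      have hcl : IsClosed (⋃ k ∈ {k : F i | 0 < x i k},
          {x | x ∈ multistrategies E ∧ f i x ≤ f i (profile i k (others i x))}) :=
        (Set.toFinite _).isClosed_biUnion fun k _ => hclosed i k (hFD i k.2)
      have hsub : (Set.univ.pi fun j => convexHull ℝ (S j) ∩ D j) ⊆
          ⋃ k ∈ {k : F i | 0 < x i k},
            {x | x ∈ multistrategies E ∧ f i x ≤ f i (profile i k (others i x))} := by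
        intro z hz
        have hzD : z ∈ multistrategies D := fun j => (hz j trivial).2
        obtain ⟨_, ⟨k, hk, rfl⟩, hle⟩ := (h_convex i _ (others_mem hzD i)).exists_le (hSD i)
          (hz i trivial).1 (hz i trivial).2
        rw [profile_eta] at hle
        exact Set.mem_biUnion hk ⟨fun j => (hD j).subset (hzD j), hle⟩
      -- The alternative may vary with the approximant, but a finite union of closed sets is closed,
      -- so one of them serves at the limit.
      obtain ⟨k, hk, hkx⟩ := Set.mem_iUnion₂.1 (closure_minimal hsub hcl hmem)
      exact ⟨k, hk, hkx⟩)
  refine ⟨ψ x, fun i => ?_, fun i y hy => (hxG i ⟨y, hy⟩).2⟩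
  exact (hE_convex i).sum_mem (fun k _ => (hx i trivial).1 k) (hx i trivial).2
    fun k _ => (hD i).subset (hFD i k.2)

end Game

end SelfSegmentDense

/-! ### Existence of an equilibrium -/

open SelfSegmentDense in
theorem mainTheorem5 {n : ℕ} {X : Fin n → Type*}
    [∀ i, AddCommGroup (X i)] [∀ i, Module ℝ (X i)] [∀ i, TopologicalSpace (X i)]
    [∀ i, IsTopologicalAddGroup (X i)] [∀ i, ContinuousSMul ℝ (X i)]
    [∀ i, T2Space (X i)] [∀ i, LocallyConvexSpace ℝ (X i)]
    (E D : ∀ i, Set (X i)) (f : Fin n → (∀ j, X j) → ℝ)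
    (hE_nonempty : ∀ i, (E i).Nonempty)
    (hE_convex : ∀ i, Convex ℝ (E i))
    (hE_compact : ∀ i, IsCompact (E i))
    (hD : ∀ i, SelfSegmentDense.IsSelfSegmentDense (D i) (E i))
    (h_lsc : ∀ i, LowerSemicontinuousOn (f i) (SelfSegmentDense.multistrategies E))
    (h_usc_others : ∀ i, ∀ y ∈ D i,
      UpperSemicontinuousOn (fun z => f i (SelfSegmentDense.profile i y z))
        (SelfSegmentDense.othersSet E i))
    (h_usc_own : ∀ i, ∀ z ∈ SelfSegmentDense.othersSet E i,
      SelfSegmentDense.UpperSemicontinuousAtPointsOf (E i) (E i \ D i)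
        (fun y => f i (SelfSegmentDense.profile i y z)))
    (h_convex : ∀ i, ∀ z ∈ SelfSegmentDense.othersSet D i,
      SelfSegmentDense.IsConvexOnSet (D i) (fun y => f i (SelfSegmentDense.profile i y z))) :
    ∃ x, SelfSegmentDense.IsNoncooperativeEquilibrium E f x := by
  classical
  have hEc : IsCompact (multistrategies E) := by
    rw [multistrategies_eq_pi]
    exact isCompact_univ_pi hE_compact
  have hclosed : ∀ i, ∀ y ∈ D i,
      IsClosed {x | x ∈ multistrategies E ∧ f i x ≤ f i (profile i y (others i x))} :=
    fun i y hy => isClosed_setOf_le_of_semicontinuousOn hEc.isClosed (h_lsc i)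
      ((h_usc_others i y hy).comp (continuous_others i).continuousOn fun x hx => others_mem hx i)
  have hDne : ∀ i, (D i).Nonempty := fun i =>
    closure_nonempty_iff.1 ((hE_nonempty i).mono (hD i).dense)
  choose d hd using hDne
  obtain ⟨x, hxE, hx⟩ := hEc.inter_iInter_nonempty
    (fun p : Σ i, D i =>
      {x | x ∈ multistrategies E ∧ f p.1 x ≤ f p.1 (profile p.1 p.2 (others p.1 x))})
    (fun p => hclosed p.1 p.2 p.2.2) (by
      intro u
      obtain ⟨x, hxE, hx⟩ := exists_forall_finset_le hE_convex hD h_convex hclosed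
        -- Adding `d i` gives an alternative to the players on whom the finite family `u` imposes no
        -- condition.
        (fun i => insert (d i) ((u.preimage (Sigma.mk i) sigma_mk_injective.injOn).image (↑)))
        (fun i => Finset.insert_nonempty _ _)
        (by
          intro i y hy
          simp only [Finset.coe_insert, Set.mem_insert_iff, Finset.mem_coe,
            Finset.mem_image] at hy
          rcases hy with rfl | ⟨q, -, rfl⟩
          · exact hd i
          · exact q.2)
      refine ⟨x, hxE, Set.mem_iInter₂.2 fun p hp => ⟨hxE, hx p.1 p.2 ?_⟩⟩
      exact Finset.mem_insert_of_mem
        (Finset.mem_image_of_mem _ (Finset.mem_preimage.2 hp)))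
  rw [Set.mem_iInter] at hx
  have hxD : ∀ i, ∀ y ∈ D i, f i x ≤ f i (profile i y (others i x)) :=
    fun i y hy => (hx ⟨i, y, hy⟩).2
  refine ⟨x, hxE, fun i => ⟨hxE i, ?_⟩⟩
  refine ⟨?_, fun b hb => hb ⟨x i, hxE i, rfl⟩⟩
  rintro _ ⟨y, hy, rfl⟩
  simp only [profile_eta]
  by_cases hyD : y ∈ D i
  · exact hxD i y hyD
  -- A profitable deviation outside `D i` would, by upper semicontinuity within `E i`, remain
  -- profitable at nearby points of the dense set `D i`.
  by_contra! hlt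
  have h := eventually_nhdsWithin_iff.1
    (h_usc_own i _ (others_mem hxE i) y ⟨hy, hyD⟩ _ hlt)
  obtain ⟨y', hy', h'⟩ :=
    ((mem_closure_iff_frequently.1 ((hD i).dense hy)).and_eventually h).exists
  exact absurd (hxD i y' hy') (not_le.2 (h' ((hD i).subset hy')))
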